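/- **Setting.** There are $n$ agents; agent $i$ has a type space $T_i\subseteq[0,\infty)$, an interval containing $0$ (for instance $T_i=[0,\infty)$), and $T=T_1\times\dots\times T_n$. An allocation function is a Borel map $A=(A_1,\dots,A_n):\mathbb R^n\to\mathbb R_+^n$. It is *monotone* if each $A_i(b_i,b_{-i})$ is weakly increasing in $b_i$ for fixed $b_{-i}$, and *bounded* if all $A_i$ are bounded. A single-call reduction $(\mu,\{\lambda_i\})$ consists of a measurable family of Borel probability measures $\mu_b$ on $\mathbb R^n$ and of real-valued payment functions $\lambda_i(a,\hat b,b)$, where $a\in\mathbb R_+^n$, such that $\hat b\mapsto\lambda_i(A(\hat b),\hat b,b)$ is $\mu_b$-integrable for all bounded monotone $A$, all $i$ and all $b\in T$. Given reported bids $b\in T$ it samples $\hat b\sim\mu_b$, realizes the allocation $A(\hat b)$ and charges agent $i$ the payment $\lambda_i(A(\hat b),\hat b,b)$. Write $\mathcal A_i(b)=\mathbb E_{\hat b\sim\mu_b}[A_i(\hat b)]$ and $\mathcal P_i(b)=\mathbb E_{\hat b\sim\mu_b}[\lambda_i(A(\hat b),\hat b,b)]$. The resulting mechanism is, in expectation,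 - *truthful* if $b_i\mathcal A_i(b)-\mathcal P_i(b)\ge b_i\mathcal A_i(y,b_{-i})-\mathcal P_i(y,b_{-i})$ for all $i$, $b\in T$, $y\in T_i$; - *individually rational* if $b_i\mathcal A_i(b)-\mathcal P_i(b)\ge0$ for all $i$, $b\in T$; - *without positive transfers* if $\mathcal P_i(b)\ge0$ for all $i$, $b\in T$. For $b\in T$ let $\dot\mu_{b,i}$ be the finite signed measure $$\dot\mu_{b,i}(B)=b_i\,\mu_b(B)-\int_0^{b_i}\mu_{(u,b_{-i})}(B)\,du .$$ **Theorem.** The mechanisms obtained from $(\mu,\{\lambda_i\})$ for all bounded monotone allocation functions $A$ are truthful, individually rational and without positive transfers in expectation if and only if the following three conditions hold. 1. For every Borel, monotone, locally bounded $A$, all $i$, all $b\in T$ and all $b_i'\in T_i$ with $b_i'\ge b_i$: $\mathbb E_{\hat b\sim\mu_b}[A_i(\hat b)]\le\mathbb E_{\hat b\sim\mu_{(b_i',b_{-i})}}[A_i(\hat b)]$ (expectations in $[0,\infty]$). 2. For all $i$ and all $b\in T$, the signed measure $\dot\mu_{b,i}$ is absolutely continuous with respect to $\mu_b$. 3. There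 are functions $\lambda_i^0(\hat b,b)$ such that for all $i$ and $b\in T$, $\lambda_i^0(\cdot,b)$ is $\mu_b$-integrable with $\mathbb E_{\hat b\sim\mu_b}[\lambda_i^0(\hat b,b)]=0$, and for every bounded monotone $A$ $$\lambda_i(A(\hat b),\hat b,b)=\rho_{b,i}(\hat b)\,A_i(\hat b)+\lambda_i^0(\hat b,b)\qquad\text{for }\mu_b\text{-almost every }\hat b,$$ where $\rho_{b,i}$ is the Radon–Nikodym density of $\dot\mu_{b,i}$ with respect to $\mu_b$. Moreover, condition 2 is equivalent to: for all $i$, all $b\in T$ and all Borel sets $B$, if $\int_0^{b_i}\mu_{(u,b_{-i})}(B)\,du\neq0$ then $\mu_b(B)\neq0$. -/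

import Mathlib

open MeasureTheory ProbabilityTheory Topology
open scoped NNReal ENNReal

noncomputable section

namespace SingleCall

/-- Bid vectors of `n` agents, with the (sup metric) topology and the Borel sigma-algebra of `ℝⁿ`. -/
abbrev Bid (n : ℕ) : Type := Fin n → ℝ

/-- Single-parameter allocation functions `A = (A₁, …, Aₙ) : ℝⁿ → ℝ₊ⁿ`. -/
abbrev Alloc (n : ℕ) : Type := Bid n → Fin n → ℝ≥0

/-- Payment functions `λ_i (a, b̂, b)`: agent, realized allocation vector, resampled bid,
reported bid. -/
abbrev Payment (n : ℕ) : Type := Fin n → (Fin n → ℝ≥0) → Bid n → Bid n → ℝ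

variable {n : ℕ}

/-- Monotone allocation function: every `A_i` is weakly increasing in the bid of agent `i`, the bids
of the others being fixed. -/
def Alloc.IsMonotone (A : Alloc n) : Prop :=
  ∀ (i : Fin n) (b : Bid n) (x y : ℝ), x ≤ y →
    A (Function.update b i x) i ≤ A (Function.update b i y) i

/-- Bounded allocation function. -/
def Alloc.IsBounded (A : Alloc n) : Prop :=
  ∃ C : ℝ≥0, ∀ (b : Bid n) (i : Fin n), A b i ≤ C

/-- Locally bounded allocation function. -/
def Alloc.IsLocallyBounded (A : Alloc n) : Prop :=
  ∀ b : Bid n, ∃ C : ℝ≥0, ∀ᶠ x in 𝓝 b, ∀ i : Fin n, A x i ≤ C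

/-- The allocation functions that a reduction receives: Borel, monotone and bounded. -/
structure Alloc.Admissible (A : Alloc n) : Prop where
  measurable : Measurable A
  monotone : A.IsMonotone
  bounded : A.IsBounded

/-- The type spaces considered: every `T i` is an interval of nonnegative reals that contains `0`
(for example `[0, ∞)`, the case of positive types). -/
def IsTypeSpace (T : Fin n → Set ℝ) : Prop :=
  ∀ i, (T i).OrdConnected ∧ (0 : ℝ) ∈ T i ∧ T i ⊆ Set.Ici 0

/-- The single-call mechanism for `A` at the reported bids `b`: expected allocation of agent `i`,
`E_{b̂ ∼ μ_b} [A_i(b̂)]`. -/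
def expAlloc (μ : Kernel (Bid n) (Bid n)) (A : Alloc n) (i : Fin n) (b : Bid n) : ℝ :=
  ∫ x, (A x i : ℝ) ∂(μ b)

/-- Expected payment of agent `i`, `E_{b̂ ∼ μ_b} [λ_i(A(b̂), b̂, b)]`. -/
def expPay (μ : Kernel (Bid n) (Bid n)) (pay : Payment n) (A : Alloc n) (i : Fin n)
    (b : Bid n) : ℝ :=
  ∫ x, pay i (A x) x b ∂(μ b)

/-- All payments of the reduction are integrable. -/
def PayIntegrable (T : Fin n → Set ℝ) (μ : Kernel (Bid n) (Bid n)) (pay : Payment n) : Prop :=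
  ∀ A : Alloc n, A.Admissible → ∀ (i : Fin n) (b : Bid n), (∀ j, b j ∈ T j) →
    Integrable (fun x => pay i (A x) x b) (μ b)

/-- Truthfulness in expectation of the mechanism for `A`: if `b i` is the type of agent `i`, then
reporting `b i` is at least as good as reporting any `y ∈ T i`, whatever the others bid. -/
def Truthful (T : Fin n → Set ℝ) (μ : Kernel (Bid n) (Bid n)) (pay : Payment n)
    (A : Alloc n) : Prop :=
  ∀ (i : Fin n) (b : Bid n), (∀ j, b j ∈ T j) → ∀ y ∈ T i,
    b i * expAlloc μ A i (Function.update b i y) - expPay μ pay A i (Function.update b i y)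
      ≤ b i * expAlloc μ A i b - expPay μ pay A i b

/-- Individual rationality in expectation. -/
def IndividuallyRational (T : Fin n → Set ℝ) (μ : Kernel (Bid n) (Bid n)) (pay : Payment n)
    (A : Alloc n) : Prop :=
  ∀ (i : Fin n) (b : Bid n), (∀ j, b j ∈ T j) →
    0 ≤ b i * expAlloc μ A i b - expPay μ pay A i b

/-- No positive transfers in expectation. -/
def NoPositiveTransfers (T : Fin n → Set ℝ) (μ : Kernel (Bid n) (Bid n)) (pay : Payment n)
    (A : Alloc n) : Prop :=
  ∀ (i : Fin n) (b : Bid n), (∀ j, b j ∈ T j) → 0 ≤ expPay μ pay A i b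

/-- The induced allocation is monotone in expectation for every Borel, monotone, locally bounded
allocation function. For such `A` the expectation may be `+∞`, so it is `[0, ∞]`-valued. -/
def MonotoneInExpectation (T : Fin n → Set ℝ) (μ : Kernel (Bid n) (Bid n)) : Prop :=
  ∀ A : Alloc n, Measurable A → A.IsMonotone → A.IsLocallyBounded →
    ∀ (i : Fin n) (b : Bid n), (∀ j, b j ∈ T j) → ∀ y ∈ T i, b i ≤ y →
      ∫⁻ x, (A x i : ℝ≥0∞) ∂(μ b) ≤ ∫⁻ x, (A x i : ℝ≥0∞) ∂(μ (Function.update b i y))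

/-- The measure `B ↦ ∫₀^{b_i} μ_{(u, b_{-i})}(B) du`. -/
def averagedMeasure (μ : Kernel (Bid n) (Bid n)) (i : Fin n) (b : Bid n) : Measure (Bid n) :=
  (volume.restrict (Set.Ioc 0 (b i))).bind
    (μ.comap (fun u : ℝ => Function.update b i u) (measurable_update b))

instance (μ : Kernel (Bid n) (Bid n)) [IsMarkovKernel μ] (i : Fin n) (b : Bid n) :
    IsFiniteMeasure (averagedMeasure μ i b) := by
  unfold averagedMeasure
  infer_instance

/-- The signed measure `B ↦ b_i μ_b(B) - ∫₀^{b_i} μ_{(u, b_{-i})}(B) du`. -/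
def priceMeasure (μ : Kernel (Bid n) (Bid n)) [IsMarkovKernel μ] (i : Fin n) (b : Bid n) :
    SignedMeasure (Bid n) :=
  b i • (μ b).toSignedMeasure - (averagedMeasure μ i b).toSignedMeasure

theorem priceMeasure_apply (μ : Kernel (Bid n) (Bid n)) [IsMarkovKernel μ] (i : Fin n) (b : Bid n)
    (hb : 0 ≤ b i) {B : Set (Bid n)} (hB : MeasurableSet B) :
    priceMeasure μ i b B =
      b i * (μ b).real B - ∫ u in (0 : ℝ)..b i, (μ (Function.update b i u)).real B := by
  have h : (averagedMeasure μ i b).real B =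
      ∫ u in (0 : ℝ)..b i, (μ (Function.update b i u)).real B := by
    rw [intervalIntegral.integral_of_le hb, averagedMeasure, Measure.real,
      Measure.bind_apply hB (Kernel.aemeasurable _)]
    simp only [Measure.real, Kernel.comap_apply]
    rw [integral_toReal]
    · exact ((Kernel.measurable_coe μ hB).comp (measurable_update b)).aemeasurable
    · exact Filter.Eventually.of_forall fun u => measure_lt_top _ _
  simp [priceMeasure, Measure.toSignedMeasure_apply_measurable hB, h]

/-- The Radon-Nikodym density of `priceMeasure μ i b` with respect to `μ_b`. -/
def priceDensity (μ : Kernel (Bid n) (Bid n)) [IsMarkovKernel μ] (i : Fin n) (b : Bid n) :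
    Bid n → ℝ :=
  (priceMeasure μ i b).rnDeriv (μ b)

/-- For all agents and bids, `priceMeasure μ i b` is absolutely continuous with respect to `μ_b`. -/
def PriceAbsolutelyContinuous (T : Fin n → Set ℝ) (μ : Kernel (Bid n) (Bid n))
    [IsMarkovKernel μ] : Prop :=
  ∀ (i : Fin n) (b : Bid n), (∀ j, b j ∈ T j) →
    VectorMeasure.AbsolutelyContinuous (priceMeasure μ i b) (μ b).toENNRealVectorMeasure

/-- Payments equal the density times `A_i(b̂)`, plus a term `λ⁰_i(b̂, b)` that does not depend on the
allocation function and has mean zero, almost surely for every admissible `A`. -/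
def PaymentForm (T : Fin n → Set ℝ) (μ : Kernel (Bid n) (Bid n)) [IsMarkovKernel μ]
    (pay : Payment n) : Prop :=
  ∃ pay₀ : Fin n → Bid n → Bid n → ℝ, ∀ (i : Fin n) (b : Bid n), (∀ j, b j ∈ T j) →
    (Integrable (fun x => pay₀ i x b) (μ b) ∧ ∫ x, pay₀ i x b ∂(μ b) = 0) ∧
    ∀ A : Alloc n, A.Admissible →
      ∀ᵐ x ∂(μ b), pay i (A x) x b = priceDensity μ i b x * (A x i : ℝ) + pay₀ i x b

end SingleCall

end

/-! Myerson's argument turns the three incentive properties into monotonicity of the expected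
allocation in the own bid plus the identity `P_i(b) = b_i 𝒜_i(b) - ∫₀^{b_i} 𝒜_i(u, b_{-i}) du`
(`expPay_eq`, `mechanism_of_payment_identity`). The right side is the integral of `A_i` against
`priceMeasure`, so if that measure has density `ρ` with respect to `μ_b`, payments `ρ A_i` plus a
mean-zero term satisfy the identity.

Conversely, the identity holds for every admissible `A`, and setting `A` to zero outside an upper
set `H` keeps it admissible. Outside `H` the payment is then that of the zero allocation, which has
mean zero, so the identity localizes to `H`. Upper orthants form a generating π-system, hence it
holds on every Borel set (`setIntegral_payment`). The constant allocation 1 then yields absolute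
continuity, and a general `A` yields the almost sure payment formula. -/

namespace SingleCall

/-! ### Upper orthants as a determining class. -/

section Orthants

/-- The closed upper orthants generate the Borel sigma-algebra of `ℝⁿ`. -/
theorem pi_eq_generateFrom_Ici (n : ℕ) :
    (inferInstance : MeasurableSpace (Bid n)) =
      MeasurableSpace.generateFrom (Set.range (Set.Ici : Bid n → Set (Bid n))) := by
  have hspan : IsCountablySpanning (Set.range (Set.Ici : ℝ → Set ℝ)) := by
    refine ⟨fun k => Set.Ici (-(k : ℝ)), fun k => ⟨_, rfl⟩, ?_⟩
    refine Set.eq_univ_of_forall fun x => Set.mem_iUnion.2 ?_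
    obtain ⟨k, hk⟩ := exists_nat_ge (-x)
    exact ⟨k, by simp only [Set.mem_Ici]; linarith⟩
  have hgen : MeasurableSpace.generateFrom (Set.range (Set.Ici : ℝ → Set ℝ)) =
      (inferInstance : MeasurableSpace ℝ) := by
    rw [← borel_eq_generateFrom_Ici]
    exact (BorelSpace.measurable_eq (α := ℝ)).symm
  have h := generateFrom_eq_pi (fun _ : Fin n => hgen) (fun _ => hspan)
  refine h.symm.trans ?_
  congr 1
  ext s
  constructor
  · rintro ⟨t, ht, rfl⟩
    choose a ha using fun i => ht i (Set.mem_univ i)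
    refine ⟨a, ?_⟩
    rw [← Set.pi_univ_Ici]
    exact Set.pi_congr rfl fun i _ => ha i
  · rintro ⟨a, rfl⟩
    exact ⟨fun i => Set.Ici (a i), fun i _ => ⟨a i, rfl⟩, Set.pi_univ_Ici a⟩

theorem isPiSystem_range_Ici (n : ℕ) :
    IsPiSystem (Set.range (Set.Ici : Bid n → Set (Bid n))) := by
  rintro _ ⟨a, rfl⟩ _ ⟨c, rfl⟩ -
  exact ⟨a ⊔ c, Set.Ici_inter_Ici.symm⟩

/-- Integrals against two measures that agree on the whole space and on all closed upper orthants
agree on all Borel sets. -/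
theorem setIntegral_eq_of_Ici {n : ℕ} {m ν : Measure (Bid n)} {f g : Bid n → ℝ}
    (hf : Integrable f m) (hg : Integrable g ν) (huniv : ∫ x, f x ∂m = ∫ x, g x ∂ν)
    (hIci : ∀ a : Bid n, ∫ x in Set.Ici a, f x ∂m = ∫ x in Set.Ici a, g x ∂ν)
    {B : Set (Bid n)} (hB : MeasurableSet B) : ∫ x in B, f x ∂m = ∫ x in B, g x ∂ν := by
  induction B, hB using MeasurableSpace.induction_on_inter (pi_eq_generateFrom_Ici n)
    (isPiSystem_range_Ici n) with
  | empty => simp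
  | basic t ht =>
    obtain ⟨a, rfl⟩ := ht
    exact hIci a
  | compl t ht ih => rw [setIntegral_compl ht hf, setIntegral_compl ht hg, huniv, ih]
  | iUnion t hd ht ih =>
    rw [integral_iUnion ht hd hf.integrableOn, integral_iUnion ht hd hg.integrableOn]
    exact tsum_congr ih

end Orthants

/-! ### Admissible allocations and their expectations. -/

section Admissible

variable {n : ℕ}

theorem Alloc.Admissible.integrable {A : Alloc n} (hA : A.Admissible) (m : Measure (Bid n))
    [IsFiniteMeasure m] (i : Fin n) : Integrable (fun x => (A x i : ℝ)) m := by
  obtain ⟨C, hC⟩ := hA.bounded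
  refine Integrable.of_bound (C := C) ?_ (.of_forall fun x => ?_)
  · exact (measurable_coe_nnreal_real.comp
      ((measurable_pi_apply i).comp hA.measurable)).aestronglyMeasurable
  · rw [Real.norm_of_nonneg (A x i).coe_nonneg]
    exact_mod_cast hC x i

theorem admissible_const (c : ℝ≥0) : Alloc.Admissible (fun _ _ => c : Alloc n) :=
  ⟨measurable_const, fun _ _ _ _ _ => le_rfl, c, fun _ _ => le_rfl⟩

/-- An admissible allocation function set to zero outside an upper set is admissible. -/
theorem Alloc.Admissible.indicator {A : Alloc n} (hA : A.Admissible) {H : Set (Bid n)}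
    (hH : IsUpperSet H) (hm : MeasurableSet H) : Alloc.Admissible (H.indicator A) := by
  refine ⟨hA.measurable.indicator hm, fun i b x y hxy => ?_, ?_⟩
  · by_cases hx : Function.update b i x ∈ H
    · have hy : Function.update b i y ∈ H := hH (update_le_update_iff.2 ⟨hxy, by simp⟩) hx
      rw [Set.indicator_of_mem hx, Set.indicator_of_mem hy]
      exact hA.monotone i b x y hxy
    · rw [Set.indicator_of_notMem hx]
      exact zero_le
  · obtain ⟨C, hC⟩ := hA.bounded
    refine ⟨C, fun b i => ?_⟩
    by_cases hb : b ∈ H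
    · rw [Set.indicator_of_mem hb]
      exact hC b i
    · rw [Set.indicator_of_notMem hb]
      exact zero_le

/-- Truncating a Borel monotone allocation function gives an admissible one. -/
theorem admissible_min {A : Alloc n} (hA : Measurable A) (hmono : A.IsMonotone) (c : ℝ≥0) :
    Alloc.Admissible (fun x j => min (A x j) c : Alloc n) := by
  refine ⟨measurable_pi_lambda _ fun j => ?_, fun i b x y hxy => ?_, c, fun _ _ => min_le_right _ _⟩
  · exact ((measurable_pi_apply j).comp hA).min measurable_const
  · exact min_le_min_right c (hmono i b x y hxy)

theorem Alloc.Admissible.isLocallyBounded {A : Alloc n} (hA : A.Admissible) :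
    A.IsLocallyBounded := by
  obtain ⟨C, hC⟩ := hA.bounded
  exact fun _ => ⟨C, .of_forall fun x => hC x⟩

theorem expAlloc_nonneg (μ : Kernel (Bid n) (Bid n)) (A : Alloc n) (i : Fin n) (b : Bid n) :
    0 ≤ expAlloc μ A i b :=
  integral_nonneg fun x => (A x i).coe_nonneg

theorem ofReal_expAlloc (μ : Kernel (Bid n) (Bid n)) [IsMarkovKernel μ] {A : Alloc n}
    (hA : A.Admissible) (i : Fin n) (b : Bid n) :
    ENNReal.ofReal (expAlloc μ A i b) = ∫⁻ x, (A x i : ℝ≥0∞) ∂(μ b) := by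
  rw [expAlloc, ofReal_integral_eq_lintegral_ofReal (hA.integrable _ i)
    (.of_forall fun x => (A x i).coe_nonneg)]
  simp

theorem integral_averagedMeasure (μ : Kernel (Bid n) (Bid n)) [IsMarkovKernel μ] {A : Alloc n}
    (hA : A.Admissible) (i : Fin n) (b : Bid n) (hb : 0 ≤ b i) :
    ∫ x, (A x i : ℝ) ∂(averagedMeasure μ i b) =
      ∫ u in (0 : ℝ)..b i, expAlloc μ A i (Function.update b i u) := by
  have hAi : Measurable fun x => (A x i : ℝ≥0∞) :=
    measurable_coe_nnreal_ennreal.comp ((measurable_pi_apply i).comp hA.measurable)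
  have hmeas : Measurable fun u : ℝ => ∫⁻ x, (A x i : ℝ≥0∞) ∂(μ (Function.update b i u)) :=
    (hAi.lintegral_kernel (κ := μ)).comp (measurable_update b)
  have h1 : ∫ x, (A x i : ℝ) ∂(averagedMeasure μ i b) =
      (∫⁻ x, (A x i : ℝ≥0∞) ∂(averagedMeasure μ i b)).toReal := by
    rw [← integral_toReal hAi.aemeasurable (.of_forall fun x => ENNReal.coe_lt_top)]
    rfl
  rw [h1, averagedMeasure, Measure.lintegral_bind (Kernel.aemeasurable _) hAi.aemeasurable,
    intervalIntegral.integral_of_le hb]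
  simp only [Kernel.comap_apply]
  rw [← integral_toReal hmeas.aemeasurable]
  · refine integral_congr_ae (.of_forall fun u => ?_)
    simp only [← ofReal_expAlloc μ hA]
    exact ENNReal.toReal_ofReal (expAlloc_nonneg _ _ _ _)
  · refine .of_forall fun u => ?_
    rw [← ofReal_expAlloc μ hA]
    exact ENNReal.ofReal_lt_top

end Admissible

/-! ### The price measure and its density. -/

section Price

variable {n : ℕ} (μ : Kernel (Bid n) (Bid n)) [IsMarkovKernel μ] (i : Fin n) (b : Bid n)

/-- On a `μ_b`-null set the term `b_i μ_b` vanishes and only minus the averaged measure is left.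
This replaces a signed condition by one on positive measures. -/
theorem priceMeasure_absolutelyContinuous_iff :
    VectorMeasure.AbsolutelyContinuous (priceMeasure μ i b) (μ b).toENNRealVectorMeasure ↔
      averagedMeasure μ i b ≪ μ b := by
  have key : ∀ B : Set (Bid n), MeasurableSet B → μ b B = 0 →
      priceMeasure μ i b B = -(averagedMeasure μ i b).real B := fun B hB h0 => by
    simp [priceMeasure, Measure.toSignedMeasure_apply_measurable hB, Measure.real, h0]
  constructor
  · refine fun h => Measure.AbsolutelyContinuous.mk fun B hB h0 => ?_
    have h1 := h (s := B) (by rwa [Measure.toENNRealVectorMeasure_apply_measurable hB])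
    rw [key B hB h0, neg_eq_zero] at h1
    exact (measureReal_eq_zero_iff).1 h1
  · refine fun h => VectorMeasure.AbsolutelyContinuous.mk fun B hB h0 => ?_
    rw [Measure.toENNRealVectorMeasure_apply_measurable hB] at h0
    rw [key B hB h0, Measure.real, h h0]
    simp

theorem averagedMeasure_absolutelyContinuous_iff (hb : 0 ≤ b i) :
    averagedMeasure μ i b ≪ μ b ↔ ∀ B : Set (Bid n), MeasurableSet B →
      (∫ u in (0 : ℝ)..b i, (μ (Function.update b i u)).real B) ≠ 0 → μ b B ≠ 0 := by
  have key : ∀ B : Set (Bid n), MeasurableSet B →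
      (∫ u in (0 : ℝ)..b i, (μ (Function.update b i u)).real B) =
        (averagedMeasure μ i b).real B := fun B hB => by
    have h := priceMeasure_apply μ i b hb hB
    simp only [priceMeasure, FunLike.coe_sub, FunLike.coe_smul, Pi.sub_apply,
      Pi.smul_apply, Measure.toSignedMeasure_apply_measurable hB, smul_eq_mul] at h
    linarith
  constructor
  · intro h B hB hne h0
    exact hne (by rw [key B hB, Measure.real, h h0, ENNReal.toReal_zero])
  · refine fun h => Measure.AbsolutelyContinuous.mk fun B hB h0 => ?_
    by_contra hne
    refine h B hB ?_ h0
    rw [key B hB]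
    exact fun h1 => hne ((measureReal_eq_zero_iff).1 h1)

instance haveLebesgueDecomposition_averagedMeasure :
    (averagedMeasure μ i b).HaveLebesgueDecomposition (μ b) :=
  Measure.haveLebesgueDecomposition_of_sigmaFinite _ _

/-- Uniqueness of the Lebesgue decomposition, with zero singular part. -/
theorem priceDensity_ae_eq (h : averagedMeasure μ i b ≪ μ b) :
    priceDensity μ i b =ᵐ[μ b]
      fun x => b i - ((averagedMeasure μ i b).rnDeriv (μ b) x).toReal := by
  have hr : Integrable (fun x => ((averagedMeasure μ i b).rnDeriv (μ b) x).toReal) (μ b) :=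
    Measure.integrable_toReal_rnDeriv
  have hint := (integrable_const (μ := μ b) (b i)).sub hr
  refine (SignedMeasure.eq_rnDeriv 0 _ hint VectorMeasure.MutuallySingular.zero_left ?_).symm
  rw [zero_add]
  ext B hB
  rw [withDensityᵥ_apply hint hB]
  simp only [Pi.sub_apply]
  rw [integral_sub (integrable_const _).integrableOn hr.integrableOn,
    Measure.setIntegral_toReal_rnDeriv h B]
  simp [priceMeasure, Measure.toSignedMeasure_apply_measurable hB, mul_comm]

theorem integral_priceDensity_mul (h : averagedMeasure μ i b ≪ μ b) (hb : 0 ≤ b i) {A : Alloc n}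
    (hA : A.Admissible) :
    Integrable (fun x => priceDensity μ i b x * (A x i : ℝ)) (μ b) ∧
    ∫ x, priceDensity μ i b x * (A x i : ℝ) ∂(μ b) =
      b i * expAlloc μ A i b - ∫ u in (0 : ℝ)..b i, expAlloc μ A i (Function.update b i u) := by
  have hint := (integrable_rnDeriv_smul_iff h).2 (hA.integrable (averagedMeasure μ i b) i)
  have hae : (fun x => priceDensity μ i b x * (A x i : ℝ)) =ᵐ[μ b] fun x => b i * (A x i : ℝ) -
      ((averagedMeasure μ i b).rnDeriv (μ b) x).toReal • (A x i : ℝ) := by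
    filter_upwards [priceDensity_ae_eq μ i b h] with x hx
    rw [hx, sub_mul, smul_eq_mul]
  have hconst := (hA.integrable (μ b) i).const_mul (b i)
  refine ⟨(hconst.sub hint).congr hae.symm, ?_⟩
  rw [integral_congr_ae hae, integral_sub hconst hint, integral_const_mul,
    integral_rnDeriv_smul h, integral_averagedMeasure μ hA i b hb, expAlloc]

end Price

/-! ### Recovering a function from its subgradients. -/

section Myerson

/-- A function with nondecreasing slope selection `a` on `[0, t]` is the integral of `a`. -/
theorem sub_eq_intervalIntegral_of_subgradient {U a : ℝ → ℝ} {t : ℝ} (ht : 0 ≤ t)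
    (hU : ∀ x ∈ Set.Icc 0 t, ∀ y ∈ Set.Icc 0 t, a x * (y - x) ≤ U y - U x) :
    U t - U 0 = ∫ u in (0 : ℝ)..t, a u := by
  have hmono : MonotoneOn a (Set.Icc 0 t) := by
    intro x hx y hy hxy
    rcases hxy.eq_or_lt with rfl | hlt
    · exact le_rfl
    · have h1 := hU x hx y hy
      have h2 := hU y hy x hx
      by_contra hlt'
      nlinarith [mul_pos (sub_pos.2 hlt) (sub_pos.2 (not_le.1 hlt'))]
  have hii : ∀ x ∈ Set.Icc 0 t, ∀ y ∈ Set.Icc 0 t, IntervalIntegrable a volume x y :=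
    fun x hx y hy => (hmono.mono (Set.uIcc_subset_Icc hx hy)).intervalIntegrable
  have h0 : (0 : ℝ) ∈ Set.Icc 0 t := ⟨le_rfl, ht⟩
  -- The increment of `U` and the integral of `a` both lie between `a x * (y - x)` and `a y * (y -
  -- x)`.
  have step : ∀ x ∈ Set.Icc 0 t, ∀ y ∈ Set.Icc 0 t, x ≤ y →
      |(U y - U x) - ∫ u in x..y, a u| ≤ (a y - a x) * (y - x) := by
    intro x hx y hy hxy
    have h1 := hU x hx y hy
    have h2 := hU y hy x hx
    have h3 : a x * (y - x) ≤ ∫ u in x..y, a u := by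
      have := intervalIntegral.integral_mono_on hxy intervalIntegrable_const (hii x hx y hy)
        (f := fun _ => a x) fun u hu => hmono hx ⟨hx.1.trans hu.1, hu.2.trans hy.2⟩ hu.1
      simpa [mul_comm] using this
    have h4 : ∫ u in x..y, a u ≤ a y * (y - x) := by
      have := intervalIntegral.integral_mono_on hxy (hii x hx y hy) intervalIntegrable_const
        (g := fun _ => a y) fun u hu => hmono ⟨hx.1.trans hu.1, hu.2.trans hy.2⟩ hy hu.2
      simpa [mul_comm] using this
    rw [abs_le]
    constructor <;> nlinarith
  -- On a uniform grid with `N + 1` cells the errors from `step` telescope to the total rise of `a`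
  -- times the mesh.
  have bound : ∀ N : ℕ, |(U t - U 0) - ∫ u in (0 : ℝ)..t, a u| ≤
      (a t - a 0) * t * (1 / ((N : ℝ) + 1)) := by
    intro N
    have hN : (0 : ℝ) < (N : ℝ) + 1 := by positivity
    set p : ℕ → ℝ := fun k => k * (t / ((N : ℝ) + 1)) with hp
    have hd : 0 ≤ t / ((N : ℝ) + 1) := by positivity
    have hpN : p (N + 1) = t := by simp only [hp]; push_cast; field_simp
    have hp0 : p 0 = 0 := by simp [hp]
    have hpmono : Monotone p := fun k l hkl =>
      mul_le_mul_of_nonneg_right (by exact_mod_cast hkl) hd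
    have hpsub : ∀ k, p (k + 1) - p k = t / ((N : ℝ) + 1) := fun k => by
      simp only [hp]; push_cast; ring
    have hpmem : ∀ k ≤ N + 1, p k ∈ Set.Icc 0 t := fun k hk =>
      ⟨hp0 ▸ hpmono k.zero_le, hpN ▸ hpmono hk⟩
    have hind : ∀ k ≤ N + 1, |(U (p k) - U 0) - ∫ u in (0 : ℝ)..p k, a u| ≤
        (a (p k) - a 0) * (t / ((N : ℝ) + 1)) := by
      intro k
      induction k with
      | zero => simp [hp0]
      | succ k ih =>
        intro hk
        have hk' := hpmem k (by omega)
        have hk1 := hpmem (k + 1) hk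
        have h1 := ih (by omega)
        have h2 := step _ hk' _ hk1 (hpmono k.le_succ)
        rw [hpsub] at h2
        have h3 := intervalIntegral.integral_add_adjacent_intervals (hii 0 h0 _ hk')
          (hii _ hk' _ hk1)
        rw [← h3]
        rw [abs_le] at h1 h2 ⊢
        constructor <;> linarith
    have h := hind (N + 1) le_rfl
    rw [hpN] at h
    calc _ ≤ _ := h
      _ = _ := by ring
  have hlim : Filter.Tendsto (fun N : ℕ => (a t - a 0) * t * (1 / ((N : ℝ) + 1))) Filter.atTop
      (𝓝 0) := by
    simpa using tendsto_one_div_add_atTop_nhds_zero_nat.const_mul ((a t - a 0) * t)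
  have := ge_of_tendsto' hlim bound
  exact sub_eq_zero.1 (abs_nonpos_iff.1 this)

end Myerson

/-! ### Incentive properties versus the payment identity. -/

section Mechanism

variable {n : ℕ} {T : Fin n → Set ℝ} {μ : Kernel (Bid n) (Bid n)} {pay : Payment n}

theorem update_mem {b : Bid n} (hb : ∀ j, b j ∈ T j) {i : Fin n} {y : ℝ} (hy : y ∈ T i) (j : Fin n) :
    Function.update b i y j ∈ T j := by
  by_cases h : j = i
  · subst h
    simpa using hy
  · simpa [h] using hb j

/-- A type `y` may report `x`: its utility there is that of type `x` plus `y - x` times the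
allocation at `x`. So the allocation is a subgradient of truthful utility. -/
theorem Truthful.subgradient {A : Alloc n} (h : Truthful T μ pay A) {b : Bid n}
    (hb : ∀ j, b j ∈ T j) {i : Fin n} {x y : ℝ} (hx : x ∈ T i) (hy : y ∈ T i) :
    expAlloc μ A i (Function.update b i x) * (y - x) ≤
      (y * expAlloc μ A i (Function.update b i y) - expPay μ pay A i (Function.update b i y)) -
      (x * expAlloc μ A i (Function.update b i x) - expPay μ pay A i (Function.update b i x)) := by
  have := h i (Function.update b i y) (update_mem hb hy) x hx
  simp only [Function.update_self, Function.update_idem] at this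
  linarith

theorem Truthful.expAlloc_mono {A : Alloc n} (h : Truthful T μ pay A) {b : Bid n}
    (hb : ∀ j, b j ∈ T j) {i : Fin n} {y : ℝ} (hy : y ∈ T i) (hby : b i ≤ y) :
    expAlloc μ A i b ≤ expAlloc μ A i (Function.update b i y) := by
  have h1 := h.subgradient hb (hb i) hy
  have h2 := h.subgradient hb hy (hb i)
  rw [Function.update_eq_self] at h1 h2
  rcases hby.eq_or_lt with heq | hlt
  · rw [← heq, Function.update_eq_self]
  · by_contra hlt'
    nlinarith [mul_pos (sub_pos.2 hlt) (sub_pos.2 (not_le.1 hlt'))]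

theorem Icc_subset_typeSpace (hT : IsTypeSpace T) {b : Bid n} (hb : ∀ j, b j ∈ T j) (i : Fin n) :
    Set.Icc 0 (b i) ⊆ T i :=
  (hT i).1.out (hT i).2.1 (hb i)

/-- The payment identity of truthful, individually rational mechanisms without positive
transfers. -/
theorem expPay_eq (hT : IsTypeSpace T) {A : Alloc n} (ht : Truthful T μ pay A)
    (hir : IndividuallyRational T μ pay A) (hnpt : NoPositiveTransfers T μ pay A) {b : Bid n}
    (hb : ∀ j, b j ∈ T j) (i : Fin n) :
    expPay μ pay A i b =
      b i * expAlloc μ A i b - ∫ u in (0 : ℝ)..b i, expAlloc μ A i (Function.update b i u) := by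
  have hsub := Icc_subset_typeSpace hT hb i
  have h := sub_eq_intervalIntegral_of_subgradient ((hT i).2.2 (hb i))
    (U := fun y => y * expAlloc μ A i (Function.update b i y) -
      expPay μ pay A i (Function.update b i y))
    (a := fun y => expAlloc μ A i (Function.update b i y))
    fun x hx y hy => ht.subgradient hb (hsub hx) (hsub hy)
  -- At bid 0 individual rationality makes the payment nonpositive and the absence of positive
  -- transfers makes it nonnegative; this fixes the constant of integration.
  have h0 := update_mem hb (hT i).2.1
  have h1 := hir i _ h0
  have h2 := hnpt i _ h0
  simp only [Function.update_self, Function.update_eq_self, zero_mul, zero_sub] at h h1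
  linarith

theorem monotoneInExpectation_of_truthful [IsMarkovKernel μ]
    (h : ∀ A : Alloc n, A.Admissible → Truthful T μ pay A) : MonotoneInExpectation T μ := by
  intro A hA hmono _ i b hb y hy hby
  -- Truthfulness is available for bounded allocations only; truncations at `k` reach `A` by
  -- monotone convergence.
  have hsup : ∀ m : Measure (Bid n), ∫⁻ x, (A x i : ℝ≥0∞) ∂m =
      ⨆ k : ℕ, ∫⁻ x, ((min (A x i) (k : ℝ≥0) : ℝ≥0) : ℝ≥0∞) ∂m := by
    intro m
    rw [← lintegral_iSup]
    · refine lintegral_congr fun x => le_antisymm ?_ (iSup_le fun k => by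
        exact_mod_cast min_le_left _ _)
      obtain ⟨k, hk⟩ := exists_nat_ge (A x i)
      refine le_iSup_of_le k ?_
      rw [min_eq_left hk]
    · exact fun k => measurable_coe_nnreal_ennreal.comp
        (((measurable_pi_apply i).comp hA).min measurable_const)
    · intro k l hkl x
      dsimp only
      exact_mod_cast min_le_min_left (A x i) (Nat.cast_le.2 hkl)
  rw [hsup, hsup]
  refine iSup_mono fun k => ?_
  have hk := admissible_min hA hmono (k : ℝ≥0)
  have := ENNReal.ofReal_le_ofReal ((h _ hk).expAlloc_mono hb hy hby)
  rwa [ofReal_expAlloc μ hk, ofReal_expAlloc μ hk] at this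

/-- If expected payments obey the payment identity, then on every Borel set the payments differ
from those of the zero allocation by `b_i A_i dμ_b - A_i dν`, where `ν` is the averaged measure. -/
theorem setIntegral_payment [IsMarkovKernel μ] (hT : IsTypeSpace T) (hpay : PayIntegrable T μ pay)
    {b : Bid n} (hb : ∀ j, b j ∈ T j) (i : Fin n)
    (hid : ∀ A : Alloc n, A.Admissible → expPay μ pay A i b =
      b i * expAlloc μ A i b - ∫ u in (0 : ℝ)..b i, expAlloc μ A i (Function.update b i u))
    {A : Alloc n} (hA : A.Admissible) {B : Set (Bid n)} (hB : MeasurableSet B) :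
    ∫ x in B, (b i * (A x i : ℝ) - (pay i (A x) x b - pay i 0 x b)) ∂(μ b) =
      ∫ x in B, (A x i : ℝ) ∂(averagedMeasure μ i b) := by
  have hbi : 0 ≤ b i := (hT i).2.2 (hb i)
  have hzero : Alloc.Admissible (fun _ => 0 : Alloc n) := admissible_const 0
  have hint0 : Integrable (fun x => pay i 0 x b) (μ b) := hpay _ hzero i b hb
  have hint := hpay A hA i b hb
  have hdiff : Integrable (fun x => pay i (A x) x b - pay i 0 x b) (μ b) := hint.sub hint0
  have hintA := (hA.integrable (μ b) i).const_mul (b i)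
  have h0 : ∫ x, pay i 0 x b ∂(μ b) = 0 := by
    have := hid _ hzero
    simpa [expPay, expAlloc] using this
  have upper : ∀ H : Set (Bid n), IsUpperSet H → MeasurableSet H →
      ∫ x in H, (b i * (A x i : ℝ) - (pay i (A x) x b - pay i 0 x b)) ∂(μ b) =
        ∫ x in H, (A x i : ℝ) ∂(averagedMeasure μ i b) := by
    intro H hH hm
    have hadm := hA.indicator hH hm
    have h1 := hid _ hadm
    rw [← integral_averagedMeasure μ hadm i b hbi] at h1
    have e1 : (fun x => ((H.indicator A x i : ℝ≥0) : ℝ)) =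
        H.indicator fun x => (A x i : ℝ) := by
      ext x
      by_cases hx : x ∈ H <;> simp [hx]
    have e2 : expPay μ pay (H.indicator A) i b =
        ∫ x in H, (pay i (A x) x b - pay i 0 x b) ∂(μ b) := by
      -- Outside `H` the whole allocation vector is zero, and the payment sees the allocation only
      -- through its realized value.
      have : (fun x => pay i (H.indicator A x) x b) = fun x =>
          H.indicator (fun x => pay i (A x) x b - pay i 0 x b) x + pay i 0 x b := by
        ext x
        by_cases hx : x ∈ H <;> simp [hx]
      rw [expPay, this, integral_add (hdiff.indicator hm) hint0, h0, add_zero,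
        integral_indicator hm]
    rw [e2, expAlloc, e1, integral_indicator hm, integral_indicator hm] at h1
    rw [integral_sub hintA.integrableOn hdiff.integrableOn, integral_const_mul, h1]
    ring
  refine setIntegral_eq_of_Ici (hintA.sub hdiff) (hA.integrable _ i) ?_
    (fun a => upper _ (isUpperSet_Ici a) measurableSet_Ici) hB
  simpa using upper Set.univ isUpperSet_univ .univ

theorem averagedMeasure_absolutelyContinuous_of_payment [IsMarkovKernel μ] (hT : IsTypeSpace T)
    (hpay : PayIntegrable T μ pay) {b : Bid n} (hb : ∀ j, b j ∈ T j) (i : Fin n)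
    (hid : ∀ A : Alloc n, A.Admissible → expPay μ pay A i b =
      b i * expAlloc μ A i b - ∫ u in (0 : ℝ)..b i, expAlloc μ A i (Function.update b i u)) :
    averagedMeasure μ i b ≪ μ b := by
  refine Measure.AbsolutelyContinuous.mk fun B hB h0 => ?_
  -- For the constant allocation 1 the right side is the averaged measure of `B`, while the left is
  -- an integral over a `μ_b`-null set.
  have h := setIntegral_payment hT hpay hb i hid (admissible_const 1) hB
  rw [Measure.restrict_eq_zero.2 h0] at h
  simpa [measureReal_eq_zero_iff] using h.symm

theorem payment_ae_eq [IsMarkovKernel μ] (hT : IsTypeSpace T)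
    (hpay : PayIntegrable T μ pay) {b : Bid n} (hb : ∀ j, b j ∈ T j) (i : Fin n)
    (hid : ∀ A : Alloc n, A.Admissible → expPay μ pay A i b =
      b i * expAlloc μ A i b - ∫ u in (0 : ℝ)..b i, expAlloc μ A i (Function.update b i u))
    {A : Alloc n} (hA : A.Admissible) :
    ∀ᵐ x ∂(μ b), pay i (A x) x b = priceDensity μ i b x * (A x i : ℝ) + pay i 0 x b := by
  have hac := averagedMeasure_absolutelyContinuous_of_payment hT hpay hb i hid
  have hint0 : Integrable (fun x => pay i 0 x b) (μ b) := hpay _ (admissible_const 0) i b hb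
  have h := Integrable.ae_eq_of_forall_setIntegral_eq _ _
    (((hA.integrable (μ b) i).const_mul (b i)).sub ((hpay A hA i b hb).sub hint0))
    ((integrable_rnDeriv_smul_iff hac).2 (hA.integrable (averagedMeasure μ i b) i))
    fun B hB _ => (setIntegral_payment hT hpay hb i hid hA hB).trans
      (setIntegral_rnDeriv_smul hac hB).symm
  filter_upwards [h, priceDensity_ae_eq μ i b hac] with x hx hρ
  simp only [Pi.sub_apply, smul_eq_mul] at hx
  rw [hρ]
  linarith

theorem expAlloc_le_of_monotoneInExpectation [IsMarkovKernel μ] (h : MonotoneInExpectation T μ)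
    {A : Alloc n} (hA : A.Admissible) {b : Bid n} (hb : ∀ j, b j ∈ T j) {i : Fin n} {x y : ℝ}
    (hx : x ∈ T i) (hy : y ∈ T i) (hxy : x ≤ y) :
    expAlloc μ A i (Function.update b i x) ≤ expAlloc μ A i (Function.update b i y) := by
  have := h A hA.measurable hA.monotone hA.isLocallyBounded i _ (update_mem hb hx) y hy
    (by simpa using hxy)
  rw [← ofReal_expAlloc μ hA, ← ofReal_expAlloc μ hA, Function.update_idem] at this
  exact (ENNReal.ofReal_le_ofReal_iff (expAlloc_nonneg _ _ _ _)).1 this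

/-- The payment identity and monotonicity give truthfulness, individual rationality and no positive
transfers. -/
theorem mechanism_of_payment_identity [IsMarkovKernel μ] (hT : IsTypeSpace T)
    (hmono : MonotoneInExpectation T μ) {A : Alloc n} (hA : A.Admissible)
    (hid : ∀ (i : Fin n) (b : Bid n), (∀ j, b j ∈ T j) → expPay μ pay A i b =
      b i * expAlloc μ A i b - ∫ u in (0 : ℝ)..b i, expAlloc μ A i (Function.update b i u)) :
    Truthful T μ pay A ∧ IndividuallyRational T μ pay A ∧ NoPositiveTransfers T μ pay A := by
  have mono : ∀ (i : Fin n) (b : Bid n), (∀ j, b j ∈ T j) →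
      MonotoneOn (fun u => expAlloc μ A i (Function.update b i u)) (T i) := fun i b hb x hx y hy =>
    expAlloc_le_of_monotoneInExpectation hmono hA hb hx hy
  have hii : ∀ (i : Fin n) (b : Bid n), (∀ j, b j ∈ T j) → ∀ x ∈ T i, ∀ y ∈ T i,
      IntervalIntegrable (fun u => expAlloc μ A i (Function.update b i u)) volume x y :=
    fun i b hb x hx y hy =>
      ((mono i b hb).mono ((hT i).1.uIcc_subset hx hy)).intervalIntegrable
  refine ⟨fun i b hb y hy => ?_, fun i b hb => ?_, fun i b hb => ?_⟩
  · have h0 := (hT i).2.1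
    rw [hid i b hb, hid i _ (update_mem hb hy)]
    simp only [Function.update_self, Function.update_idem]
    have hadd := intervalIntegral.integral_add_adjacent_intervals (hii i b hb 0 h0 y hy)
      (hii i b hb y hy (b i) (hb i))
    -- By the identity, the loss from misreporting `y` is the right side minus the left; a monotone
    -- integrand makes it nonnegative whether `y` lies below or above `b i`.
    have hkey : (b i - y) * expAlloc μ A i (Function.update b i y) ≤
        ∫ u in y..b i, expAlloc μ A i (Function.update b i u) := by
      rcases le_total y (b i) with hyb | hyb
      · have := intervalIntegral.integral_mono_on hyb intervalIntegrable_const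
          (hii i b hb y hy (b i) (hb i))
          (f := fun _ => expAlloc μ A i (Function.update b i y)) fun u hu =>
            mono i b hb hy ((hT i).1.out hy (hb i) hu) hu.1
        simpa using this
      · have := intervalIntegral.integral_mono_on hyb (hii i b hb (b i) (hb i) y hy)
          intervalIntegrable_const
          (g := fun _ => expAlloc μ A i (Function.update b i y)) fun u hu =>
            mono i b hb ((hT i).1.out (hb i) hy hu) hy hu.2
        rw [intervalIntegral.integral_symm]
        simp only [intervalIntegral.integral_const, smul_eq_mul] at this
        linarith
    linarith
  · rw [hid i b hb, sub_sub_cancel]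
    exact intervalIntegral.integral_nonneg ((hT i).2.2 (hb i)) fun u _ => expAlloc_nonneg _ _ _ _
  · have hbi : 0 ≤ b i := (hT i).2.2 (hb i)
    have := intervalIntegral.integral_mono_on hbi (hii i b hb 0 (hT i).2.1 (b i) (hb i))
      intervalIntegrable_const (g := fun _ => expAlloc μ A i b) fun u hu => by
        have := mono i b hb (Icc_subset_typeSpace hT hb i hu) (hb i) hu.2
        simpa only [Function.update_eq_self] using this
    rw [hid i b hb, sub_nonneg]
    simpa using this

end Mechanism

end SingleCall

theorem mainTheorem6 (n : ℕ) (T : Fin n → Set ℝ) (hT : SingleCall.IsTypeSpace T)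
    (μ : ProbabilityTheory.Kernel (SingleCall.Bid n) (SingleCall.Bid n))
    [ProbabilityTheory.IsMarkovKernel μ]
    (pay : SingleCall.Payment n) (hpay : SingleCall.PayIntegrable T μ pay) :
    ((∀ A : SingleCall.Alloc n, A.Admissible →
        SingleCall.Truthful T μ pay A ∧ SingleCall.IndividuallyRational T μ pay A ∧
          SingleCall.NoPositiveTransfers T μ pay A) ↔
      (SingleCall.MonotoneInExpectation T μ ∧ SingleCall.PriceAbsolutelyContinuous T μ ∧
        SingleCall.PaymentForm T μ pay)) ∧
    (SingleCall.PriceAbsolutelyContinuous T μ ↔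
      ∀ (i : Fin n) (b : SingleCall.Bid n), (∀ j, b j ∈ T j) →
        ∀ B : Set (SingleCall.Bid n), MeasurableSet B →
          (∫ u in (0 : ℝ)..b i, (μ (Function.update b i u)).real B) ≠ 0 → μ b B ≠ 0) := by
  have hac : SingleCall.PriceAbsolutelyContinuous T μ ↔ ∀ (i : Fin n) (b : SingleCall.Bid n),
      (∀ j, b j ∈ T j) → SingleCall.averagedMeasure μ i b ≪ μ b :=
    forall₂_congr fun i b => imp_congr_right fun _ =>
      SingleCall.priceMeasure_absolutelyContinuous_iff μ i b
  refine ⟨⟨fun h => ?_, fun ⟨hmono, habs, pay₀, hpay₀⟩ A hA => ?_⟩, ?_⟩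
  · have hid : ∀ (i : Fin n) (b : SingleCall.Bid n), (∀ j, b j ∈ T j) →
        ∀ A : SingleCall.Alloc n, A.Admissible → SingleCall.expPay μ pay A i b =
          b i * SingleCall.expAlloc μ A i b -
            ∫ u in (0 : ℝ)..b i, SingleCall.expAlloc μ A i (Function.update b i u) :=
      fun i b hb A hA => SingleCall.expPay_eq hT (h A hA).1 (h A hA).2.1 (h A hA).2.2 hb i
    refine ⟨SingleCall.monotoneInExpectation_of_truthful fun A hA => (h A hA).1,
      hac.2 fun i b hb => SingleCall.averagedMeasure_absolutelyContinuous_of_payment hT hpay hb i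
        (hid i b hb),
      -- The mean-zero term is the payment charged at the zero allocation.
      fun i x b => pay i 0 x b, fun i b hb => ⟨⟨?_, ?_⟩, fun A hA => ?_⟩⟩
    · exact hpay _ (SingleCall.admissible_const 0) i b hb
    · have := hid i b hb _ (SingleCall.admissible_const 0)
      rw [SingleCall.expPay] at this
      refine Eq.trans ?_ (this.trans ?_)
      · rfl
      · simp [SingleCall.expAlloc]
    · exact SingleCall.payment_ae_eq hT hpay hb i (hid i b hb) hA
  · refine SingleCall.mechanism_of_payment_identity hT hmono hA fun i b hb => ?_
    obtain ⟨⟨hint, hzero⟩, hform⟩ := hpay₀ i b hb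
    obtain ⟨hρ, hval⟩ := SingleCall.integral_priceDensity_mul μ i b (hac.1 habs i b hb)
      ((hT i).2.2 (hb i)) hA
    rw [SingleCall.expPay, integral_congr_ae (hform A hA), integral_add hρ hint, hzero, add_zero,
      hval]
  · rw [hac]
    exact forall₂_congr fun i b => forall_congr' fun hb =>
      SingleCall.averagedMeasure_absolutelyContinuous_iff μ i b ((hT i).2.2 (hb i))
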